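/- **Setting.** Graphs are finite multigraphs without loops. An iterated graph system (IGS) consists of a connected finite graph $G_1=(V_1,E_1)$ (the generator), a non-empty finite set $I$, and for every edge $e\in E_1$ and endpoint $v\in e$ an injection $\phi_{v,e}:I\to V_1$ whose image is an independent set, with $\phi_{v,e}(I)\cap\phi_{w,e}(I)=\emptyset$ for $e=\{v,w\}$. Assume that it is * simple: there are $\phi_+,\phi_-:I\to V_1$ with $\{\phi_{v,e},\phi_{w,e}\}=\{\phi_+,\phi_-\}$ for all $e=\{v,w\}\in E_1$; put $I_\pm=\phi_\pm(I)$; * non-degenerate: no edge joins $I_+$ to $I_-$; * doubling: every $v\in I_+\cup I_-$ has degree one; its neighbour is denoted $\mathfrak n(v)$; * conductively uniform: for all $p\in(1,\infty)$ and $a\in I$, $\mathcal J_{p,+}(\phi_+(a),\mathfrak n(\phi_+(a)))=-\mathcal J_{p,+}(\phi_-(a),\mathfrak n(\phi_-(a)))$, where $\mathcal J_{p,+}$ is the unit flow from $I_+$ to $I_-$ in $G_1$ minimizing $\sum_{e\in E_1}|\mathcal J(e)|^{p/(p-1)}$. Put $\mathcal J_p(a):=\mathcal J_{p,+}(\phi_+(a),\mathfrak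 n(\phi_+(a)))$ for $a\in I$, $\mathcal E_p(g):=\sum_{\{v,w\}\in E}|g(v)-g(w)|^p$ for a function $g$ on the vertices of a graph with edges $E$, and let $\mathcal M_p$ be the infimum of $\mathcal E_p(U)$ over $U:V_1\to\mathbb R$ with $U|_{I_+}\equiv1$, $U|_{I_-}\equiv0$. The replacement graphs $G_n=(V_n,E_n)$ start with the single edge $G_0=(\{v_+,v_-\},\{e_0\})$, $\phi_{v_\pm,e_0}=\phi_\pm$; $G_{n+1}$ is obtained by replacing every $e\in E_n$ by a copy of $G_1$, i.e. $V_{n+1}=(V_1\times E_n)/\!\sim$ with $(\phi_{v,e}(a),e)\sim(\phi_{v,f}(a),f)$ whenever $v\in e\cap f$ and $a\in I$, its edges are $\{[v,e],[w,e]\}$ for $\{v,w\}\in E_1$, $e\in E_n$ (which project to $e$), and these carry the labels $\phi_{v,\{v,w\}}$, $\phi_{w,\{v,w\}}$. For $v\in e\in E_n$ and $a\in I$ put $v\cdot a:=[\phi_{v,e}(a),e]\in V_{n+1}$ (independent of $e$), and $v\cdot(a_1\dots a_k):=(\cdots(v\cdot a_1)\cdots)\cdot a_k\in V_{n+k}$.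 For $n\ge m$ and $f:V_n\to\mathbb R$ put $$V_{n,m}[f](v):=\sum_{a_1\dots a_{n-m}\in I^{n-m}}\Big(\prod_{i}\mathcal J_p(a_i)\Big)f(v\cdot(a_1\dots a_{n-m})),\qquad v\in V_m .$$ The limit space $X$ is the set of sequences $(e_n)_{n\ge0}$, $e_n\in E_n$, with $e_{n+1}$ projecting to $e_n$, modulo $(e_n)\sim(f_n)$ iff $e_n\cap f_n\ne\emptyset$ for all $n$; $\chi$ is the quotient map. It has the metric $d(\chi((e_n)),\chi((f_n)))=\lim_n\min_{v\in e_n,w\in f_n}d_n(v,w)$, where $d_n(v,w)=\inf_\Omega\sum_{x\in\Omega}L_*^{-|x|}$, with $L_*$ the graph distance of $I_+$ and $I_-$ in $G_1$ and $|x|=j$ for $x\in E_j$; here $\Omega$ runs over the sets of edges in $\bigcup_{j\le n}E_j$ such that the endpoints of all edges of $G_n$ projecting to an element of $\Omega$ form a connected subset of $G_n$ that contains $v$ and $w$. For $v\in e\in E_n$ and $a\in I^{\mathbb N}$ let $T_{v,e}(a)$ be the sequence consisting of the projections of $e$ to the levels at most $n$ and, at level $n+k$ with $k\ge 1$, of the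 unique edge that projects to $e$ and contains $v\cdot(a_1\dots a_k)$. The fiber of $v$ is $\mathrm{Fib}(v)=\chi(T_{v,e}(I^{\mathbb N}))$. If $\mathcal J_p$ is a probability density on $I$, the fiber measure $\mathcal J_{p,v}$ is the image under $\chi\circ T_{v,e}$ of the Bernoulli measure on $I^{\mathbb N}$ with weights $\mathcal J_p$ (neither depends on $e\ni v$), and the discretization operators are $$V_n[f](v):=\int_{\mathrm{Fib}(v)}f\,d\mathcal J_{p,v},\qquad f\in C(X),\ v\in V_n .$$ **Theorem.** Let $p\in(1,\infty)$. Then $\mathcal J_p$ is a probability density on $I$, and: 1. For all integers $n\ge m\ge0$ and all $f:V_n\to\mathbb R$, $$\mathcal E_p(V_{n,m}[f])\le\mathcal M_p^{-(n-m)}\,\mathcal E_p(f).$$ 2. For every $f\in C(X)$ the sequence $\mathcal M_p^{-n}\mathcal E_p(V_n[f])$, $n\ge0$, is non-decreasing; in particular $\lim_{n\to\infty}\mathcal M_p^{-n}\mathcal E_p(V_n[f])$ exists in $[0,\infty]$. -/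

import Mathlib

open Set Filter Topology MeasureTheory
open scoped ENNReal

universe u

/-! ## Finite multigraphs and discrete potential theory -/

/-- A finite multigraph.  An edge is an unordered pair of endpoints, presented by an arbitrary
enumeration `ends e true`, `ends e false` of its two endpoints; parallel edges are allowed.
Loops are excluded where the generator of an iterated graph system is introduced. -/
structure MultiGraph where
  V : Type u
  E : Type u
  [finV : Finite V]
  [fintypeE : Fintype E]
  ends : E → Bool → V

attribute [instance] MultiGraph.finV MultiGraph.fintypeE

namespace MultiGraph

variable (G : MultiGraph.{u})

/-- The underlying adjacency relation, as a simple graph: it gives the paths, connectedness and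
the path metric of the multigraph. -/
def toSimple : SimpleGraph G.V where
  Adj v w := v ≠ w ∧ ∃ e b, G.ends e b = v ∧ G.ends e (!b) = w
  symm := ⟨fun v w h => by
    obtain ⟨hne, e, b, h1, h2⟩ := h
    exact ⟨hne.symm, e, !b, h2, by simpa using h1⟩⟩
  loopless := ⟨fun _ h => h.1 rfl⟩

/-- The number of edges (with multiplicity) that contain `v`. -/
noncomputable def degree (v : G.V) : ℕ := Nat.card {e : G.E // ∃ b, G.ends e b = v}

/-- The graph `p`-energy `∑_{{v,w} ∈ E} |g v - g w| ^ p`. -/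
noncomputable def energy (p : ℝ) (g : G.V → ℝ) : ℝ :=
  ∑ e, |g (G.ends e true) - g (G.ends e false)| ^ p

/-- The `p`-capacity between `A` and `B`. -/
noncomputable def capacity (p : ℝ) (A B : Set G.V) : ℝ :=
  sInf {x | ∃ U : G.V → ℝ, (∀ v ∈ A, U v = 1) ∧ (∀ v ∈ B, U v = 0) ∧ G.energy p U = x}

open Classical in
/-- The divergence `div J v = ∑_{{v,w} ∈ E} J v w`. -/
noncomputable def divergence (J : G.V → G.V → ℝ) (v : G.V) : ℝ :=
  ∑ e, ∑ b, if G.ends e b = v then J v (G.ends e (!b)) else 0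

/-- Unit flows from `A` to `B`. -/
structure IsUnitFlow (A B : Set G.V) (J : G.V → G.V → ℝ) : Prop where
  antisymm : ∀ v w, J v w = -J w v
  support : ∀ v w, ¬ G.toSimple.Adj v w → J v w = 0
  divergence_eq_zero : ∀ v, v ∉ A ∪ B → G.divergence J v = 0
  unit : ∑ᶠ v ∈ A, G.divergence J v = 1

/-- The `q`-energy `∑_{{v,w} ∈ E} |J v w| ^ q` of a flow. -/
noncomputable def flowEnergy (q : ℝ) (J : G.V → G.V → ℝ) : ℝ :=
  ∑ e, |J (G.ends e true) (G.ends e false)| ^ q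

/-- `J` solves the `p`-resistance problem between `A` and `B`: it is a unit flow from `A` to `B`
of minimal `q`-energy, `q = p / (p - 1)` being the dual exponent. -/
def IsOptimalFlow (p : ℝ) (A B : Set G.V) (J : G.V → G.V → ℝ) : Prop :=
  G.IsUnitFlow A B J ∧
    ∀ J', G.IsUnitFlow A B J' → G.flowEnergy (p / (p - 1)) J ≤ G.flowEnergy (p / (p - 1)) J'

/-- The optimal unit flow from `A` to `B`. -/
noncomputable def optimalFlow (p : ℝ) (A B : Set G.V) : G.V → G.V → ℝ :=
  Classical.epsilon (G.IsOptimalFlow p A B)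

end MultiGraph

/-! ## Iterated graph systems -/

/-- An iterated graph system: a generator `(V, E)`, a gluing set `I`, and for every edge `e` and
every endpoint `v = ends e b` of `e` a gluing map `φ e b = φ_{v,e} : I → V`. -/
structure IGS extends MultiGraph.{u} where
  I : Type u
  [fintypeI : Fintype I]
  [nonemptyI : Nonempty I]
  φ : E → Bool → I → V
  loopless : ∀ e, ends e true ≠ ends e false
  connected : toMultiGraph.toSimple.Connected
  φ_injective : ∀ e b, Function.Injective (φ e b)
  φ_independent : ∀ e b a a', ¬ toMultiGraph.toSimple.Adj (φ e b a) (φ e b a')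
  φ_disjoint : ∀ e, Disjoint (range (φ e true)) (range (φ e false))

attribute [instance] IGS.fintypeI IGS.nonemptyI

/-- An iterated graph system that is simple (with `glue true = φ_+` and `glue false = φ_-`),
non-degenerate and doubling. -/
structure GeometricIGS extends IGS.{u} where
  glue : Bool → I → V
  simple : ∀ e, ({φ e true, φ e false} : Set (I → V)) = {glue true, glue false}
  nondegenerate : ∀ a a', ¬ toMultiGraph.toSimple.Adj (glue true a) (glue false a')
  doubling : ∀ s a, toMultiGraph.degree (glue s a) = 1

namespace GeometricIGS

variable (S : GeometricIGS.{u})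

/-- Every vertex of the generator is an endpoint of some edge. -/
theorem exists_dart (v : S.V) : ∃ d : S.E × Bool, S.ends d.1 d.2 = v := by
  classical
  obtain ⟨a⟩ := S.nonemptyI
  have h1 := S.doubling true a
  have hne : Nonempty {e : S.E // ∃ b, S.ends e b = S.glue true a} := by
    by_contra h
    rw [not_nonempty_iff] at h
    rw [MultiGraph.degree, Nat.card_of_isEmpty] at h1
    exact zero_ne_one h1
  obtain ⟨e, b, he⟩ := hne
  by_cases hv : v = S.ends e b
  · exact ⟨(e, b), hv.symm⟩
  · obtain ⟨p⟩ := S.connected.preconnected v (S.ends e b)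
    cases p with
    | nil => exact absurd rfl hv
    | cons h _ =>
      obtain ⟨_, f, c, hc, _⟩ := h
      exact ⟨(f, c), hc⟩

/-- A dart of the generator at `v`, that is, an edge containing `v` together with the index of `v`
among its endpoints.  It is unique if `v` lies in `I_+ ∪ I_-`, where `v` has degree one. -/
noncomputable def dartAt (v : S.V) : S.E × Bool := (S.exists_dart v).choose

/-- The neighbour of `v` along `dartAt v`: the unique neighbour `𝔫(v)` if `v ∈ I_+ ∪ I_-`. -/
noncomputable def leafNeighbor (v : S.V) : S.V := S.ends (S.dartAt v).1 (!(S.dartAt v).2)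

/-- The `p`-capacity constant `M_p = Cap_p(I_+, I_-, G_1)`. -/
noncomputable def capConst (p : ℝ) : ℝ :=
  S.toMultiGraph.capacity p (range (S.glue true)) (range (S.glue false))

/-- The optimal unit flow `J_{p,+}` from `I_+` to `I_-` in the generator. -/
noncomputable def flow (p : ℝ) : S.V → S.V → ℝ :=
  S.toMultiGraph.optimalFlow p (range (S.glue true)) (range (S.glue false))

/-- Conductive uniformity. -/
def ConductivelyUniform : Prop :=
  ∀ p : ℝ, 1 < p → ∀ a : S.I,
    S.flow p (S.glue true a) (S.leafNeighbor (S.glue true a)) =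
      -S.flow p (S.glue false a) (S.leafNeighbor (S.glue false a))

/-- The function `J_p` on the gluing set, `J_p(a) = J_{p,+}(φ_+(a), 𝔫(φ_+(a)))`. -/
noncomputable def fluxDensity (p : ℝ) (a : S.I) : ℝ :=
  S.flow p (S.glue true a) (S.leafNeighbor (S.glue true a))

/-! ## Replacement graphs -/

/-- Graphs labelled by the generator: for every edge `e` and endpoint `v = ends e b` a map
`lab e b = φ_{v,e} : I → V₁`.  Every vertex lies on an edge. -/
structure LabeledGraph (S : GeometricIGS.{u}) extends MultiGraph.{u} where
  lab : E → Bool → S.I → S.V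
  exists_dart : ∀ v, ∃ d : E × Bool, ends d.1 d.2 = v

/-- The level-zero graph: one edge with endpoints `v_+` (index `true`) and `v_-` (index `false`),
labelled by `φ_+` and `φ_-`. -/
def levelZero : S.LabeledGraph where
  V := ULift Bool
  E := PUnit
  ends _ b := ⟨b⟩
  lab _ b := S.glue b
  exists_dart v := ⟨(PUnit.unit, v.down), rfl⟩

/-- The identifications `(φ_{v,e}(a), e) ∼ (φ_{v,f}(a), f)` on `V₁ × E`, where `v` is a common
endpoint of the edges `e` and `f`. -/
def glueRel (G : S.LabeledGraph) (x y : S.V × G.E) : Prop :=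
  ∃ b c a, G.ends x.2 b = G.ends y.2 c ∧ x.1 = G.lab x.2 b a ∧ y.1 = G.lab y.2 c a

/-- The replacement rule: every edge `e` of `G` is replaced by a copy of the generator.  The edge
`(e, f)` is the copy of the edge `f` of the generator that replaces part of `e`, and it projects
to `e`. -/
def replace (G : S.LabeledGraph) : S.LabeledGraph where
  V := Quot (S.glueRel G)
  E := G.E × S.E
  ends d b := Quot.mk _ (S.ends d.2 b, d.1)
  lab d b := S.φ d.2 b
  exists_dart v := by
    induction v using Quot.ind with
    | mk x =>
      obtain ⟨d, hd⟩ := S.exists_dart x.1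
      exact ⟨((x.2, d.1), d.2), by simp [hd]⟩

/-- The replacement graphs `G_0, G_1, G_2, …`. -/
def G : ℕ → S.LabeledGraph
  | 0 => S.levelZero
  | n + 1 => S.replace (G n)

/-- A dart at a vertex `v` of `G_n`: an edge containing `v` and the index of `v` in it. -/
noncomputable def dart {n : ℕ} (v : (S.G n).V) : (S.G n).E × Bool :=
  ((S.G n).exists_dart v).choose

/-- The vertex `v · a = [φ_{v,e}(a), e]` of `G_{n+1}`, for `v ∈ V_n` and `a ∈ I`. -/
noncomputable def extend {n : ℕ} (v : (S.G n).V) (a : S.I) : (S.G (n + 1)).V :=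
  Quot.mk _ ((S.G n).lab (S.dart v).1 (S.dart v).2 a, (S.dart v).1)

/-- The vertex `v · a` does not depend on the edge `e` that contains `v`. -/
theorem extend_eq {n : ℕ} (v : (S.G n).V) (a : S.I) (e : (S.G n).E) (b : Bool)
    (h : (S.G n).ends e b = v) :
    S.extend v a = Quot.mk (S.glueRel (S.G n)) ((S.G n).lab e b a, e) :=
  Quot.sound ⟨(S.dart v).2, b, a, (((S.G n).exists_dart v).choose_spec).trans h.symm, rfl, rfl⟩

/-- The higher order gluing maps: `v · a ∈ V_{m+k}` for `v ∈ V_m` and a word `a ∈ I^k`. -/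
noncomputable def extendWord {m : ℕ} (v : (S.G m).V) : (k : ℕ) → (Fin k → S.I) → (S.G (m + k)).V
  | 0, _ => v
  | k + 1, a => S.extend (extendWord v k (Fin.init a)) (a (Fin.last k))

/-- The averaging operator `V_{n,m} : ℝ^{V_n} → ℝ^{V_m}`, `n = m + k`, for a density `ν` on `I`:
`V_{n,m}[f](v) = ∑_{a ∈ I^k} ν(a_1) ⋯ ν(a_k) f(v · a)`. -/
noncomputable def average (ν : S.I → ℝ) (m k : ℕ) (f : (S.G (m + k)).V → ℝ) (v : (S.G m).V) : ℝ :=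
  ∑ a : Fin k → S.I, (∏ i, ν (a i)) * f (S.extendWord v k a)

/-! ## The limit space -/

/-- The edge `e_n = ω_0 ω_1 ⋯ ω_{n-1}` of `G_n` that belongs to a sequence of edges of the
generator.  This identifies `E₁^ℕ` with the projective sequences `(e_n)`, `e_n ∈ E_n`. -/
def word (ω : ℕ → S.E) : (n : ℕ) → (S.G n).E
  | 0 => PUnit.unit
  | n + 1 => (word ω n, ω n)

/-- The underlying set of the limit space: two sequences are identified when `e_n` and `f_n` have
a common vertex for all `n`. -/
def LimitSpace : Type u :=
  Quot fun ω η : ℕ → S.E =>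
    ∀ n, ∃ b c, (S.G n).ends (S.word ω n) b = (S.G n).ends (S.word η n) c

/-- The coding map. -/
def coding (ω : ℕ → S.E) : S.LimitSpace := Quot.mk _ ω

/-- `L_* = dist(I_+, I_-)`, in the path metric of the generator. -/
noncomputable def scale : ℕ :=
  sInf {l | ∃ a a', S.toMultiGraph.toSimple.dist (S.glue true a) (S.glue false a') = l}

/-- The edges `π_{n,j}(e) ∈ E_j`, `0 ≤ j ≤ n`, to which an edge `e ∈ E_n` projects. -/
def projections : (n : ℕ) → (S.G n).E → Set (Σ j, (S.G j).E)
  | 0, e => {⟨0, e⟩}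
  | n + 1, e => insert ⟨n + 1, e⟩ (projections n e.1)

/-- The vertex set `⋃_{x ∈ Ω} x · G_{n - |x|}` in `G_n`: the endpoints of all edges of `G_n` that
project to an element of `Ω`. -/
def cells (n : ℕ) (Ω : Finset (Σ j, (S.G j).E)) : Set (S.G n).V :=
  {w | ∃ e b, (S.G n).ends e b = w ∧ ∃ x ∈ Ω, x ∈ S.projections n e}

/-- `d_n(v, w)`: the infimum of `∑_{x ∈ Ω} L_*^{-|x|}` over all sets `Ω` of edges of level at most
`n` whose cells form a connected subset of `G_n` that contains `v` and `w`. -/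
noncomputable def levelDist (n : ℕ) (v w : (S.G n).V) : ℝ :=
  sInf {c | ∃ Ω : Finset (Σ j, (S.G j).E), (∀ x ∈ Ω, x.1 ≤ n) ∧
    ((S.G n).toSimple.induce (S.cells n Ω)).Preconnected ∧
    v ∈ S.cells n Ω ∧ w ∈ S.cells n Ω ∧ c = ∑ x ∈ Ω, ((S.scale : ℝ)⁻¹) ^ x.1}

/-- `lim_n d_n(e_n, f_n)`, where `d_n(e_n, f_n)` is the minimum of `d_n` over the endpoints.  The
limit exists, and is written as a limit superior. -/
noncomputable def codeDist (ω η : ℕ → S.E) : ℝ :=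
  limsup (fun n => ⨅ bc : Bool × Bool,
    S.levelDist n ((S.G n).ends (S.word ω n) bc.1) ((S.G n).ends (S.word η n) bc.2)) atTop

/-- The metric of the limit space, `d(χ(ω), χ(η)) = lim_n d_n(e_n, f_n)`.  The right-hand side does
not depend on the codings `ω`, `η` of the two points, so the infimum is over equal numbers. -/
noncomputable def limitDist (x y : S.LimitSpace) : ℝ :=
  sInf {r | ∃ ω η, S.coding ω = x ∧ S.coding η = y ∧ S.codeDist ω η = r}

/-- The metric topology of `limitDist`. -/
instance : TopologicalSpace S.LimitSpace where
  IsOpen U := ∀ x ∈ U, ∃ ε > 0, ∀ y, S.limitDist x y < ε → y ∈ U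
  isOpen_univ := fun _ _ => ⟨1, one_pos, fun _ _ => mem_univ _⟩
  isOpen_inter := fun s t hs ht x hx => by
    obtain ⟨ε, hε, h1⟩ := hs x hx.1
    obtain ⟨δ, hδ, h2⟩ := ht x hx.2
    exact ⟨min ε δ, lt_min hε hδ, fun y hy =>
      ⟨h1 y (hy.trans_le (min_le_left _ _)), h2 y (hy.trans_le (min_le_right _ _))⟩⟩
  isOpen_sUnion := fun s hs x hx => by
    obtain ⟨t, ht, hxt⟩ := hx
    obtain ⟨ε, hε, h⟩ := hs t ht x hxt
    exact ⟨ε, hε, fun y hy => ⟨t, ht, h y hy⟩⟩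

instance : MeasurableSpace S.LimitSpace := borel _

instance : BorelSpace S.LimitSpace := ⟨rfl⟩

/-! ## Fibers, fiber measures and discretization operators -/

instance : MeasurableSpace S.I := ⊤

/-- For a dart `(e, v)` of `G_n` and `a ∈ I`, the dart `(𝔢(v · a, e), v · a)` of `G_{n+1}`: the
edge is the unique one that projects to `e` and contains `v · a`. -/
noncomputable def childDart {n : ℕ} (d : (S.G n).E × Bool) (a : S.I) : (S.G (n + 1)).E × Bool :=
  ((d.1, (S.dartAt ((S.G n).lab d.1 d.2 a)).1), (S.dartAt ((S.G n).lab d.1 d.2 a)).2)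

/-- For a dart `(e, v)`, the dart `(𝔢(v · a_0 ⋯ a_{k-1}, e), v · a_0 ⋯ a_{k-1})` of `G_{n+k}`. -/
noncomputable def descend {n : ℕ} (d : (S.G n).E × Bool) (a : ℕ → S.I) :
    (k : ℕ) → (S.G (n + k)).E × Bool
  | 0 => d
  | k + 1 => S.childDart (descend d a k) (a k)

/-- The sequence that starts with the `n` letters of the edge `e ∈ E_n` and goes on with `ω`. -/
def prepend : (n : ℕ) → (S.G n).E → (ℕ → S.E) → (ℕ → S.E)
  | 0, _, ω => ω
  | n + 1, e, ω => prepend n e.1 (fun k => Nat.casesOn k e.2 ω)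

/-- The map `χ ∘ T_{v,e} : I^ℕ → X` for a dart `d = (e, v)` of `G_n`; the coding sequence of
`T_{v,e}(a)` consists of the projections of `e` and the edges `𝔢(v · a_0 ⋯ a_{k-1}, e)`.  The image
of this map is the fiber `Fib(v)`. -/
noncomputable def fiberMap {n : ℕ} (d : (S.G n).E × Bool) (a : ℕ → S.I) : S.LimitSpace :=
  S.coding (S.prepend n d.1 fun k => (S.descend d a (k + 1)).1.2)

/-- Probability densities on the gluing set. -/
structure IsDensity (ν : S.I → ℝ) : Prop where
  nonneg : ∀ a, 0 ≤ ν a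
  sum_eq_one : ∑ a, ν a = 1

/-- The probability measure on the gluing set with density `ν`. -/
noncomputable def gluingMeasure (ν : S.I → ℝ) (hν : S.IsDensity ν) : Measure S.I :=
  (PMF.ofFintype (fun a => ENNReal.ofReal (ν a)) (by
    rw [← ENNReal.ofReal_sum_of_nonneg fun a _ => hν.nonneg a, hν.sum_eq_one,
      ENNReal.ofReal_one])).toMeasure

instance (ν : S.I → ℝ) (hν : S.IsDensity ν) : IsProbabilityMeasure (S.gluingMeasure ν hν) :=
  PMF.toMeasure.isProbabilityMeasure _

/-- The fiber measure on `Fib(v)` of a density `ν`: the image under `χ ∘ T_{v,e}`, for an edge `e`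
containing `v`, of the Bernoulli measure on `I^ℕ` with weights `ν`. -/
noncomputable def fiberMeasure (ν : S.I → ℝ) (hν : S.IsDensity ν) {n : ℕ} (v : (S.G n).V) :
    Measure S.LimitSpace :=
  (Measure.infinitePi fun _ : ℕ => S.gluingMeasure ν hν).map (S.fiberMap (S.dart v))

/-- The discretization operator `V_n : C(X) → ℝ^{V_n}` of a density `ν`, which averages over the
fibers: `V_n[f](v) = ∫_{Fib(v)} f dν_v`. -/
noncomputable def discretize (ν : S.I → ℝ) (hν : S.IsDensity ν) (n : ℕ) (f : C(S.LimitSpace, ℝ))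
    (v : (S.G n).V) : ℝ :=
  ∫ x, f x ∂(S.fiberMeasure ν hν v)

end GeometricIGS

/-! Everything rests on a one-step estimate: averaging from level `n + 1` to level `n` with weights
`J_p` increases the energy by at most the factor `M_p⁻¹` (`energy_averageStep_le`). Inside the copy
of the generator replacing an edge `e`, conductive uniformity and summation by parts turn the
difference of the two averages at the endpoints of `e` into the pairing of the optimal flow with the
gradient of the function on that copy (`sum_fluxDensity_mul_sub`). Hölder's inequality bounds its
`p`-th power by (flow energy)^(p-1) times the energy of the copy. By duality the first factor is
`M_p⁻¹`: the optimal flow is the normalized `p`-gradient of the equilibrium potential `U`, by Hölder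
for optimality and by strict convexity for uniqueness. The bound `U ≤ 1` makes `J_p` nonnegative.

Iterating the estimate gives the first claim. For the second, `V_n[f]` is the one-step average of
`V_{n+1}[f]` (`discretize_eq_averageStep`): a Bernoulli sequence is an independent first letter
followed by a Bernoulli sequence, and prescribing the first letter passes from the fiber of `v` to
that of `v · x`. Fubini requires continuity of the maps onto the fibers, hence an upper bound for
the metric, obtained by joining two points through a single cell. -/

namespace MultiGraph

variable (G : MultiGraph.{u})

/-! ### Pairing flows with gradients -/

/-- Summation by parts for antisymmetric functions of pairs of vertices. -/
theorem sum_divergence_mul [Fintype G.V] {J : G.V → G.V → ℝ} (hJ : ∀ v w, J v w = -J w v)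
    (F : G.V → ℝ) :
    ∑ v, G.divergence J v * F v =
      ∑ e, J (G.ends e true) (G.ends e false) * (F (G.ends e true) - F (G.ends e false)) := by
  classical
  simp only [divergence, Finset.sum_mul]
  rw [Finset.sum_comm]
  refine Finset.sum_congr rfl fun e _ => ?_
  rw [Finset.sum_comm]
  simp only [Fintype.sum_bool, ite_mul, zero_mul, Finset.sum_ite_eq, Finset.mem_univ, if_true,
    Bool.not_true, Bool.not_false]
  rw [hJ (G.ends e false) (G.ends e true)]
  ring

/-- A flow tested against a function that is `1` on the source and `0` on the sink. -/
theorem finsum_divergence_eq {A B : Set G.V} {J : G.V → G.V → ℝ}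
    (hJ : ∀ v w, J v w = -J w v) (hdiv : ∀ v, v ∉ A ∪ B → G.divergence J v = 0) {U : G.V → ℝ}
    (hA : ∀ v ∈ A, U v = 1) (hB : ∀ v ∈ B, U v = 0) :
    ∑ᶠ v ∈ A, G.divergence J v =
      ∑ e, J (G.ends e true) (G.ends e false) * (U (G.ends e true) - U (G.ends e false)) := by
  classical
  have := Fintype.ofFinite G.V
  rw [← G.sum_divergence_mul hJ, finsum_mem_def, finsum_eq_sum_of_fintype]
  refine Finset.sum_congr rfl fun v _ => ?_
  by_cases hvA : v ∈ A
  · simp [hvA, hA v hvA]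
  · by_cases hvB : v ∈ B
    · simp [hvA, hB v hvB]
    · simp [hvA, hdiv v (by simp [hvA, hvB])]

theorem energy_nonneg (p : ℝ) (g : G.V → ℝ) : 0 ≤ G.energy p g :=
  Finset.sum_nonneg fun _ _ => Real.rpow_nonneg (abs_nonneg _) _

/-- Hölder's inequality for the pairing of a flow with a gradient. -/
theorem abs_pairing_rpow_le {p : ℝ} (hp : 1 < p) (J : G.V → G.V → ℝ) (F : G.V → ℝ) :
    |∑ e, J (G.ends e true) (G.ends e false) * (F (G.ends e true) - F (G.ends e false))| ^ p ≤
      G.flowEnergy (p / (p - 1)) J ^ (p - 1) * G.energy p F := by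
  have hp0 : (0 : ℝ) < p := one_pos.trans hp
  have hp1 : (0 : ℝ) < p - 1 := sub_pos.2 hp
  have hpq : (p / (p - 1)).HolderConjugate p := (Real.HolderConjugate.conjExponent hp).symm
  have h := Real.inner_le_Lp_mul_Lq Finset.univ
    (fun e => |J (G.ends e true) (G.ends e false)|)
    (fun e => |F (G.ends e true) - F (G.ends e false)|) hpq
  simp only [abs_abs] at h
  have hf : 0 ≤ G.flowEnergy (p / (p - 1)) J :=
    Finset.sum_nonneg fun _ _ => Real.rpow_nonneg (abs_nonneg _) _
  have h2 : |∑ e, J (G.ends e true) (G.ends e false) *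
      (F (G.ends e true) - F (G.ends e false))| ≤
      G.flowEnergy (p / (p - 1)) J ^ (1 / (p / (p - 1))) * G.energy p F ^ (1 / p) := by
    refine (Finset.abs_sum_le_sum_abs _ _).trans ?_
    simp only [abs_mul]
    exact h
  refine (Real.rpow_le_rpow (abs_nonneg _) h2 hp0.le).trans_eq ?_
  rw [Real.mul_rpow (Real.rpow_nonneg hf _) (Real.rpow_nonneg (G.energy_nonneg p F) _),
    ← Real.rpow_mul hf, ← Real.rpow_mul (G.energy_nonneg p F)]
  congr 2
  · field_simp
  · rw [one_div, inv_mul_cancel₀ hp0.ne', Real.rpow_one]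

/-! ### Equilibrium potentials -/

/-- An equilibrium potential: a minimizer of the capacity problem with values in `[0, 1]`. -/
structure IsEquilibrium (p : ℝ) (A B : Set G.V) (U : G.V → ℝ) : Prop where
  eq_one : ∀ v ∈ A, U v = 1
  eq_zero : ∀ v ∈ B, U v = 0
  mem_Icc : ∀ v, U v ∈ Icc (0 : ℝ) 1
  le : ∀ U' : G.V → ℝ, (∀ v ∈ A, U' v = 1) → (∀ v ∈ B, U' v = 0) →
    G.energy p U ≤ G.energy p U'

/-- Compactness gives a minimizer among functions with values in `[0, 1]`. Truncation to `[0, 1]` is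
1-Lipschitz and fixes 0 and 1, so it keeps the boundary values without raising the energy, and the
minimizer is global. -/
theorem exists_isEquilibrium {p : ℝ} (hp : 1 < p) {A B : Set G.V} (hAB : Disjoint A B) :
    ∃ U, G.IsEquilibrium p A B U := by
  classical
  have hp0 : (0 : ℝ) < p := one_pos.trans hp
  let K : Set (G.V → ℝ) := {U | (∀ v ∈ A, U v = 1) ∧ (∀ v ∈ B, U v = 0)} ∩
    Set.pi univ fun _ => Icc (0 : ℝ) 1
  have hclosed : IsClosed {U : G.V → ℝ | (∀ v ∈ A, U v = 1) ∧ (∀ v ∈ B, U v = 0)} := by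
    simp only [ofPred_and, ofPred_forall]
    exact (isClosed_biInter fun v _ => isClosed_eq (continuous_apply v) continuous_const).inter
      (isClosed_biInter fun v _ => isClosed_eq (continuous_apply v) continuous_const)
  have hK : IsCompact K := (isCompact_univ_pi fun _ => isCompact_Icc).inter_left hclosed
  have hne : K.Nonempty := by
    refine ⟨A.indicator 1, ⟨fun v hv => by simp [hv], fun v hv => ?_⟩, fun v _ => ?_⟩
    · simp [hAB.notMem_of_mem_right hv]
    · by_cases hv : v ∈ A <;> simp [hv]
  have hcont : Continuous (G.energy p) := by
    unfold energy
    refine continuous_finsetSum _ fun e _ => Continuous.rpow_const ?_ fun _ => Or.inr hp0.le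
    fun_prop
  obtain ⟨U, hU, hmin⟩ := hK.exists_isMinOn hne hcont.continuousOn
  refine ⟨U, hU.1.1, hU.1.2, fun v => hU.2 v (mem_univ v), fun U' hA hB => ?_⟩
  let T : ℝ → ℝ := fun x => (projIcc (0 : ℝ) 1 zero_le_one x : ℝ)
  have hT : ∀ x y, |T x - T y| ≤ |x - y| := fun x y => abs_projIcc_sub_projIcc zero_le_one
  refine (hmin (show T ∘ U' ∈ K from ⟨⟨fun v hv => ?_, fun v hv => ?_⟩, fun v _ => ?_⟩)).trans ?_
  · simp [T, hA v hv]
  · simp [T, hB v hv]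
  · exact (projIcc (0 : ℝ) 1 zero_le_one (U' v)).2
  · exact Finset.sum_le_sum fun e _ => Real.rpow_le_rpow (abs_nonneg _) (hT _ _) hp0.le

namespace IsEquilibrium

variable {G} {p : ℝ} {A B : Set G.V} {U : G.V → ℝ}

theorem capacity_eq (hU : G.IsEquilibrium p A B U) : G.capacity p A B = G.energy p U :=
  IsLeast.csInf_eq ⟨⟨U, hU.eq_one, hU.eq_zero, rfl⟩, by
    rintro _ ⟨U', hA, hB, rfl⟩
    exact hU.le U' hA hB⟩

theorem energy_pos (hU : G.IsEquilibrium p A B U) (hp : 1 < p) (hG : G.toSimple.Connected)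
    (hA : A.Nonempty) (hB : B.Nonempty) : 0 < G.energy p U := by
  refine (G.energy_nonneg p U).lt_of_ne' fun h0 => ?_
  have hedge : ∀ e, U (G.ends e true) = U (G.ends e false) := fun e => by
    have h := (Finset.sum_eq_zero_iff_of_nonneg
      (fun _ _ => Real.rpow_nonneg (abs_nonneg _) _)).1 h0 e (Finset.mem_univ e)
    rw [Real.rpow_eq_zero (abs_nonneg _) (by linarith)] at h
    exact sub_eq_zero.1 (abs_eq_zero.1 h)
  have hadj : ∀ v w, G.toSimple.Adj v w → U v = U w := by
    rintro _ _ ⟨_, e, b, rfl, rfl⟩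
    cases b
    · exact (hedge e).symm
    · exact hedge e
  obtain ⟨a, ha⟩ := hA
  obtain ⟨b, hb⟩ := hB
  have hwalk : ∀ v w, G.toSimple.Walk v w → U v = U w := fun v w q => by
    induction q with
    | nil => rfl
    | cons h _ ih => exact (hadj _ _ h).trans ih
  obtain ⟨q⟩ := hG.preconnected a b
  have := hwalk a b q
  rw [hU.eq_one a ha, hU.eq_zero b hb] at this
  exact one_ne_zero this

/-- The Euler–Lagrange equation. -/
theorem sum_gradient_eq_zero (hU : G.IsEquilibrium p A B U) (hp : 1 < p) {h : G.V → ℝ}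
    (hh : ∀ v ∈ A ∪ B, h v = 0) :
    ∑ e, |U (G.ends e true) - U (G.ends e false)| ^ (p - 2) *
      (U (G.ends e true) - U (G.ends e false)) * (h (G.ends e true) - h (G.ends e false)) = 0 := by
  -- First variation: since `h` vanishes on `A ∪ B`, each `U + t h` is admissible, so the energy is
  -- minimal at `t = 0`.
  have hd : HasDerivAt (fun t : ℝ => G.energy p fun v => U v + t * h v)
      (∑ e, p * |U (G.ends e true) - U (G.ends e false)| ^ (p - 2) *
      (U (G.ends e true) - U (G.ends e false)) * (h (G.ends e true) - h (G.ends e false))) 0 := by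
    unfold energy
    refine HasDerivAt.fun_sum fun e _ => ?_
    have h1 : HasDerivAt (fun t : ℝ => (U (G.ends e true) + t * h (G.ends e true)) -
        (U (G.ends e false) + t * h (G.ends e false)))
        (h (G.ends e true) - h (G.ends e false)) 0 := by
      have hl : ∀ x y : ℝ, HasDerivAt (fun t : ℝ => x + t * y) y 0 := fun x y => by
        simpa using ((hasDerivAt_id (0 : ℝ)).mul_const y).const_add x
      exact (hl _ _).fun_sub (hl _ _)
    have h2 := HasDerivAt.comp (0 : ℝ) (hasDerivAt_abs_rpow _ hp) h1
    simp only [zero_mul, add_zero] at h2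
    exact h2
  have hmin : IsLocalMin (fun t : ℝ => G.energy p fun v => U v + t * h v) 0 := by
    refine Filter.Eventually.of_forall fun t => ?_
    simp only [zero_mul, add_zero]
    refine hU.le _ (fun v hv => ?_) fun v hv => ?_
    · simp [hU.eq_one v hv, hh v (Or.inl hv)]
    · simp [hU.eq_zero v hv, hh v (Or.inr hv)]
  have h0 := hmin.hasDerivAt_eq_zero hd
  simp only [mul_assoc, ← Finset.mul_sum] at h0 ⊢
  exact (mul_eq_zero.1 h0).resolve_left (by linarith)

end IsEquilibrium

/-! ### Optimal flows: duality and uniqueness -/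

open Classical in
/-- The flow `c⁻¹ |∇U| ^ (p - 2) ∇U` of a function `U`. -/
noncomputable def gradientFlow (p c : ℝ) (U : G.V → ℝ) (v w : G.V) : ℝ :=
  if G.toSimple.Adj v w then c⁻¹ * (|U v - U w| ^ (p - 2) * (U v - U w)) else 0

theorem gradientFlow_antisymm (p c : ℝ) (U : G.V → ℝ) (v w : G.V) :
    G.gradientFlow p c U v w = -G.gradientFlow p c U w v := by
  unfold gradientFlow
  rw [G.toSimple.adj_comm w v, abs_sub_comm (U w) (U v)]
  split_ifs
  · ring
  · simp

theorem gradientFlow_ends (p c : ℝ) (U : G.V → ℝ) (e : G.E) :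
    G.gradientFlow p c U (G.ends e true) (G.ends e false) =
      c⁻¹ * (|U (G.ends e true) - U (G.ends e false)| ^ (p - 2) *
        (U (G.ends e true) - U (G.ends e false))) := by
  unfold gradientFlow
  split_ifs with h
  · rfl
  -- The endpoints of an edge fail to be adjacent only for a loop, which a `MultiGraph` may have.
  · have : G.ends e true = G.ends e false := by
      by_contra hne
      exact h ⟨hne, e, true, rfl, rfl⟩
    simp [this]

theorem abs_rpow_sub_two_mul_self_mul_self {p : ℝ} (hp : 1 < p) (x : ℝ) :
    |x| ^ (p - 2) * x * x = |x| ^ p := by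
  rcases eq_or_ne x 0 with rfl | hx
  · simp [Real.zero_rpow (by linarith : p ≠ 0)]
  · have hx' : 0 < |x| := abs_pos.2 hx
    rw [mul_assoc, ← abs_mul_abs_self, ← pow_two, ← Real.rpow_natCast, ← Real.rpow_add hx']
    norm_num

theorem abs_rpow_sub_two_mul_self_rpow {p : ℝ} (hp : 1 < p) (x : ℝ) :
    |(|x| ^ (p - 2) * x)| ^ (p / (p - 1)) = |x| ^ p := by
  have hp1 : (0 : ℝ) < p - 1 := sub_pos.2 hp
  rcases eq_or_ne x 0 with rfl | hx
  · rw [mul_zero, abs_zero, Real.zero_rpow (by positivity), Real.zero_rpow (by linarith)]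
  · have hx' : 0 < |x| := abs_pos.2 hx
    rw [abs_mul, abs_of_nonneg (Real.rpow_nonneg hx'.le _), ← Real.rpow_add_one hx'.ne',
      ← Real.rpow_mul hx'.le]
    congr 1
    field_simp
    ring

theorem flowEnergy_gradientFlow {p c : ℝ} (hp : 1 < p) (hc : 0 < c) (U : G.V → ℝ) :
    G.flowEnergy (p / (p - 1)) (G.gradientFlow p c U) =
      c⁻¹ ^ (p / (p - 1)) * G.energy p U := by
  unfold flowEnergy energy
  rw [Finset.mul_sum]
  refine Finset.sum_congr rfl fun e _ => ?_
  rw [gradientFlow_ends, abs_mul, Real.mul_rpow (abs_nonneg _) (abs_nonneg _),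
    abs_rpow_sub_two_mul_self_rpow hp, abs_of_pos (inv_pos.2 hc)]

/-- Testing the Euler–Lagrange equation with a point mass gives zero divergence off `A ∪ B`. Pairing
with `U` itself gives total flux energy/energy = 1. -/
theorem IsEquilibrium.isUnitFlow {G : MultiGraph.{u}} {p : ℝ} {A B : Set G.V} {U : G.V → ℝ}
    (hU : G.IsEquilibrium p A B U) (hp : 1 < p) (hpos : 0 < G.energy p U) :
    G.IsUnitFlow A B (G.gradientFlow p (G.energy p U) U) := by
  classical
  have := Fintype.ofFinite G.V
  have hdiv : ∀ v, v ∉ A ∪ B → G.divergence (G.gradientFlow p (G.energy p U) U) v = 0 := by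
    intro v hv
    have h := G.sum_divergence_mul (G.gradientFlow_antisymm p (G.energy p U) U)
      (Pi.single v (1 : ℝ))
    have h0 := hU.sum_gradient_eq_zero hp (h := Pi.single v (1 : ℝ)) fun w hw =>
      Pi.single_eq_of_ne (by rintro rfl; exact hv hw) _
    simp only [gradientFlow_ends, mul_assoc, ← Finset.mul_sum] at h h0
    rw [h0, mul_zero] at h
    simpa [Pi.single_apply] using h
  refine ⟨G.gradientFlow_antisymm p _ U, fun v w h => if_neg h, hdiv, ?_⟩
  rw [G.finsum_divergence_eq (G.gradientFlow_antisymm p _ U) hdiv hU.eq_one hU.eq_zero]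
  simp only [gradientFlow_ends, mul_assoc, ← Finset.mul_sum]
  simp only [← mul_assoc, abs_rpow_sub_two_mul_self_mul_self hp]
  exact inv_mul_cancel₀ hpos.ne'

/-- With `q = p / (p - 1)` and `c` the energy of `U`, the flow energy is `c ^ (1 - q)`, and `(1 -
q)(p - 1) = -1`. -/
theorem flowEnergy_gradientFlow_rpow {p : ℝ} (hp : 1 < p) {U : G.V → ℝ}
    (hpos : 0 < G.energy p U) :
    G.flowEnergy (p / (p - 1)) (G.gradientFlow p (G.energy p U) U) ^ (p - 1) =
      (G.energy p U)⁻¹ := by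
  have hp1 : (0 : ℝ) < p - 1 := sub_pos.2 hp
  rw [G.flowEnergy_gradientFlow hp hpos, Real.inv_rpow hpos.le, ← Real.rpow_neg hpos.le,
    ← Real.rpow_add_one hpos.ne', ← Real.rpow_mul hpos.le, ← Real.rpow_neg_one]
  congr 1
  field_simp
  ring

/-- Every unit flow pairs with `U` to 1, so Hölder bounds its flow energy to the power `p - 1` below
by the inverse energy of `U`; the gradient flow attains this bound. -/
theorem IsEquilibrium.isOptimalFlow {G : MultiGraph.{u}} {p : ℝ} {A B : Set G.V} {U : G.V → ℝ}
    (hU : G.IsEquilibrium p A B U) (hp : 1 < p) (hpos : 0 < G.energy p U) :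
    G.IsOptimalFlow p A B (G.gradientFlow p (G.energy p U) U) := by
  refine ⟨hU.isUnitFlow hp hpos, fun J hJ => ?_⟩
  have hp1 : (0 : ℝ) < p - 1 := sub_pos.2 hp
  have h := G.abs_pairing_rpow_le hp J U
  rw [← G.finsum_divergence_eq hJ.antisymm hJ.divergence_eq_zero hU.eq_one hU.eq_zero,
    hJ.unit, abs_one, Real.one_rpow] at h
  have hf : 0 ≤ G.flowEnergy (p / (p - 1)) J :=
    Finset.sum_nonneg fun _ _ => Real.rpow_nonneg (abs_nonneg _) _
  have hf' : 0 ≤ G.flowEnergy (p / (p - 1)) (G.gradientFlow p (G.energy p U) U) :=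
    Finset.sum_nonneg fun _ _ => Real.rpow_nonneg (abs_nonneg _) _
  rw [← Real.rpow_le_rpow_iff hf' hf hp1, G.flowEnergy_gradientFlow_rpow hp hpos]
  rwa [inv_le_iff_one_le_mul₀ hpos]

theorem divergence_midpoint (J J' : G.V → G.V → ℝ) (v : G.V) :
    G.divergence (fun v w => (1 / 2) * J v w + (1 / 2) * J' v w) v =
      (1 / 2) * G.divergence J v + (1 / 2) * G.divergence J' v := by
  unfold divergence
  simp only [Finset.mul_sum, ← Finset.sum_add_distrib, mul_ite, mul_zero]
  refine Finset.sum_congr rfl fun e _ => Finset.sum_congr rfl fun b _ => ?_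
  split_ifs <;> simp

/-- If `|x| = |y|` then `x = -y ≠ 0` and the midpoint is 0; otherwise strict convexity on the
half-line applies to `|x|` and `|y|`. -/
theorem abs_midpoint_rpow_lt {q : ℝ} (hq : 1 < q) {x y : ℝ} (h : x ≠ y) :
    |(1 / 2) * x + (1 / 2) * y| ^ q < (1 / 2) * |x| ^ q + (1 / 2) * |y| ^ q := by
  have hq0 : (0 : ℝ) < q := one_pos.trans hq
  by_cases hxy : |x| = |y|
  · have hy : x = -y := (abs_eq_abs.1 hxy).resolve_left h
    have hy0 : y ≠ 0 := by
      rintro rfl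
      simp [hy] at h
    have := Real.rpow_pos_of_pos (abs_pos.2 hy0) q
    rw [hxy, hy]
    simp only [mul_neg, neg_add_cancel, abs_zero, Real.zero_rpow hq0.ne']
    linarith
  · have h1 := (strictConvexOn_rpow hq).2 (abs_nonneg x) (abs_nonneg y) hxy
      (one_half_pos (α := ℝ)) one_half_pos (add_halves 1)
    simp only [smul_eq_mul] at h1
    refine lt_of_le_of_lt (Real.rpow_le_rpow (abs_nonneg _) ?_ hq0.le) h1
    refine (abs_add_le _ _).trans_eq ?_
    simp [abs_mul]

/-- Optimal flows are unique, by strict convexity. -/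
theorem IsOptimalFlow.unique {G : MultiGraph.{u}} {p : ℝ} (hp : 1 < p) {A B : Set G.V}
    {J J' : G.V → G.V → ℝ} (hJ : G.IsOptimalFlow p A B J) (hJ' : G.IsOptimalFlow p A B J') :
    J = J' := by
  have hp1 : (0 : ℝ) < p - 1 := sub_pos.2 hp
  have hq : 1 < p / (p - 1) := by rw [lt_div_iff₀ hp1]; linarith
  set q := p / (p - 1)
  have hmid : G.IsUnitFlow A B fun v w => (1 / 2) * J v w + (1 / 2) * J' v w := by
    refine ⟨fun v w => ?_, fun v w h => ?_, fun v hv => ?_, ?_⟩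
    · rw [hJ.1.antisymm, hJ'.1.antisymm]; ring
    · rw [hJ.1.support v w h, hJ'.1.support v w h]; simp
    · rw [divergence_midpoint, hJ.1.divergence_eq_zero v hv, hJ'.1.divergence_eq_zero v hv]; simp
    · simp only [divergence_midpoint]
      have hu := hJ.1.unit
      have hu' := hJ'.1.unit
      have hf : A.Finite := A.toFinite
      rw [finsum_mem_eq_finite_toFinset_sum _ hf] at hu hu' ⊢
      rw [Finset.sum_add_distrib, ← Finset.mul_sum, ← Finset.mul_sum, hu, hu']
      norm_num
  have hle := hJ.2 _ hmid
  have heq : G.flowEnergy q J = G.flowEnergy q J' := le_antisymm (hJ.2 _ hJ'.1) (hJ'.2 _ hJ.1)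
  have hends : ∀ e, J (G.ends e true) (G.ends e false) = J' (G.ends e true) (G.ends e false) := by
    by_contra! ⟨e, he⟩
    have hlt : G.flowEnergy q (fun v w => (1 / 2) * J v w + (1 / 2) * J' v w) <
        (1 / 2) * G.flowEnergy q J + (1 / 2) * G.flowEnergy q J' := by
      unfold flowEnergy
      rw [Finset.mul_sum, Finset.mul_sum, ← Finset.sum_add_distrib]
      refine Finset.sum_lt_sum (fun f _ => ?_) ⟨e, Finset.mem_univ e, abs_midpoint_rpow_lt hq he⟩
      rcases eq_or_ne (J (G.ends f true) (G.ends f false)) (J' (G.ends f true) (G.ends f false))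
        with h | h
      · simp only [h, ← add_mul]; norm_num
      · exact (abs_midpoint_rpow_lt hq h).le
    linarith
  ext v w
  by_cases h : G.toSimple.Adj v w
  · obtain ⟨_, e, b, rfl, rfl⟩ := h
    cases b
    · rw [hJ.1.antisymm, hJ'.1.antisymm]
      exact congrArg Neg.neg (hends e)
    · exact hends e
  · rw [hJ.1.support v w h, hJ'.1.support v w h]

end MultiGraph

namespace GeometricIGS

variable (S : GeometricIGS.{u})

/-! ### The generator -/

/-- The bit `s` records whether the labels of `e` are swapped relative to `(φ_+, φ_-)`. -/
theorem exists_φ_eq_glue (e : S.E) : ∃ s, ∀ b, S.φ e b = S.glue (xor b s) := by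
  rcases Set.pair_eq_pair_iff.1 (S.simple e) with ⟨h1, h2⟩ | ⟨h1, h2⟩
  · exact ⟨false, by rintro (_ | _) <;> simp [h1, h2]⟩
  · exact ⟨true, by rintro (_ | _) <;> simp [h1, h2]⟩

/-- Injectivity and disjointness are axioms for the maps `φ e b`; any single edge transfers them to
`φ_±`. -/
theorem glue_inj {s s' : Bool} {a a' : S.I} (h : S.glue s a = S.glue s' a') :
    s = s' ∧ a = a' := by
  obtain ⟨d, -⟩ := S.exists_dart (S.glue true a)
  obtain ⟨c, hc⟩ := S.exists_φ_eq_glue d.1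
  have hg : ∀ s, S.glue s = S.φ d.1 (xor s c) := fun s => by simp [hc]
  have hdisj := S.φ_disjoint d.1
  have key : xor s c = xor s' c := by
    rw [hg, hg] at h
    generalize xor s c = t at h ⊢
    generalize xor s' c = t' at h ⊢
    by_contra hne
    rcases t with _ | _ <;> rcases t' with _ | _
    · exact hne rfl
    · exact disjoint_left.1 hdisj ⟨a', rfl⟩ ⟨a, h⟩
    · exact disjoint_left.1 hdisj ⟨a, rfl⟩ ⟨a', h.symm⟩
    · exact hne rfl
  have hs : s = s' := by simpa using key
  subst hs
  refine ⟨rfl, S.φ_injective d.1 (xor s c) ?_⟩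
  rwa [← hg]

theorem glue_disjoint : Disjoint (range (S.glue true)) (range (S.glue false)) := by
  rw [disjoint_left]
  rintro _ ⟨a, rfl⟩ ⟨a', h⟩
  exact absurd (S.glue_inj h).1 (by decide)

theorem dartAt_ends (v : S.V) : S.ends (S.dartAt v).1 (S.dartAt v).2 = v :=
  (S.exists_dart v).choose_spec

theorem ends_ne_ends_not (e : S.E) (b : Bool) : S.ends e b ≠ S.ends e (!b) := by
  cases b
  · exact (S.loopless e).symm
  · exact S.loopless e

/-- The divergence at a vertex of `I_+ ∪ I_-` is the flow along the only edge. -/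
theorem divergence_glue (J : S.V → S.V → ℝ) (s : Bool) (a : S.I) :
    S.toMultiGraph.divergence J (S.glue s a) =
      J (S.glue s a) (S.leafNeighbor (S.glue s a)) := by
  classical
  have hd := S.dartAt_ends (S.glue s a)
  have huniq : ∀ e b, S.ends e b = S.glue s a → e = (S.dartAt (S.glue s a)).1 := by
    intro e b he
    have h := S.doubling s a
    rw [MultiGraph.degree, Nat.card_eq_one_iff_unique] at h
    have := h.1
    exact congrArg Subtype.val (Subsingleton.elim
      (⟨e, b, he⟩ : {e : S.E // ∃ b, S.ends e b = S.glue s a}) ⟨_, _, hd⟩)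
  unfold MultiGraph.divergence leafNeighbor
  rw [Finset.sum_eq_single (S.dartAt (S.glue s a)).1, Finset.sum_eq_single
    (S.dartAt (S.glue s a)).2, if_pos hd]
  · intro b _ hb
    refine if_neg fun h => S.ends_ne_ends_not (S.dartAt (S.glue s a)).1 b ?_
    rw [h, ← Bool.eq_not.2 hb.symm, hd]
  · simp
  · intro e _ he
    exact Finset.sum_eq_zero fun b _ => if_neg fun h => he (huniq e b h)
  · simp

/-- The optimal flow is the normalized gradient flow of the equilibrium potential. -/
theorem exists_flow_eq {p : ℝ} (hp : 1 < p) :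
    ∃ U, S.toMultiGraph.IsEquilibrium p (range (S.glue true)) (range (S.glue false)) U ∧
      0 < S.toMultiGraph.energy p U ∧ S.capConst p = S.toMultiGraph.energy p U ∧
      S.flow p = S.toMultiGraph.gradientFlow p (S.toMultiGraph.energy p U) U := by
  obtain ⟨U, hU⟩ := S.toMultiGraph.exists_isEquilibrium hp S.glue_disjoint
  have hpos := hU.energy_pos hp S.connected (range_nonempty _) (range_nonempty _)
  have hopt := hU.isOptimalFlow hp hpos
  exact ⟨U, hU, hpos, hU.capacity_eq,
    MultiGraph.IsOptimalFlow.unique hp (Classical.epsilon_spec ⟨_, hopt⟩) hopt⟩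

theorem capConst_pos {p : ℝ} (hp : 1 < p) : 0 < S.capConst p := by
  obtain ⟨U, -, h, h', -⟩ := S.exists_flow_eq hp
  exact h'.symm ▸ h

theorem isUnitFlow_flow {p : ℝ} (hp : 1 < p) :
    S.toMultiGraph.IsUnitFlow (range (S.glue true)) (range (S.glue false)) (S.flow p) := by
  obtain ⟨U, hU, hpos, -, hf⟩ := S.exists_flow_eq hp
  exact hf ▸ hU.isUnitFlow hp hpos

theorem flowEnergy_flow {p : ℝ} (hp : 1 < p) :
    S.toMultiGraph.flowEnergy (p / (p - 1)) (S.flow p) ^ (p - 1) = (S.capConst p)⁻¹ := by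
  obtain ⟨U, -, hpos, hc, hf⟩ := S.exists_flow_eq hp
  rw [hf, hc, S.toMultiGraph.flowEnergy_gradientFlow_rpow hp hpos]

/-- The potential equals its maximum 1 on `I_+`, so the gradient flow leaves `I_+`; the weights sum
to the total flux. -/
theorem isDensity_fluxDensity {p : ℝ} (hp : 1 < p) : S.IsDensity (S.fluxDensity p) := by
  refine ⟨fun a => ?_, ?_⟩
  · obtain ⟨U, hU, hpos, -, hf⟩ := S.exists_flow_eq hp
    unfold fluxDensity
    rw [hf]
    unfold MultiGraph.gradientFlow
    split_ifs
    · rw [hU.eq_one _ ⟨a, rfl⟩]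
      exact mul_nonneg (inv_nonneg.2 hpos.le) (mul_nonneg (Real.rpow_nonneg (abs_nonneg _) _)
        (sub_nonneg.2 (hU.mem_Icc _).2))
    · exact le_rfl
  · have h := (S.isUnitFlow_flow hp).unit
    rw [finsum_mem_range fun a a' h => (S.glue_inj h).2, finsum_eq_sum_of_fintype] at h
    simp only [divergence_glue] at h
    exact h

/-- Pairing the gradient of `F` with the optimal flow yields the difference of the averages of `F`
over `I_+` and `I_-`. -/
theorem sum_fluxDensity_mul_sub (hS : S.ConductivelyUniform) {p : ℝ} (hp : 1 < p) (F : S.V → ℝ) :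
    ∑ a, S.fluxDensity p a * (F (S.glue true a) - F (S.glue false a)) =
      ∑ e, S.flow p (S.ends e true) (S.ends e false) *
        (F (S.ends e true) - F (S.ends e false)) := by
  classical
  have := Fintype.ofFinite S.V
  have hflow := S.isUnitFlow_flow hp
  rw [← S.toMultiGraph.sum_divergence_mul hflow.antisymm]
  have h : ∑ x : Bool × S.I, S.toMultiGraph.divergence (S.flow p) (S.glue x.1 x.2) *
      F (S.glue x.1 x.2) = ∑ v, S.toMultiGraph.divergence (S.flow p) v * F v := by
    refine Finset.sum_of_injOn (fun x => S.glue x.1 x.2) ?_ (fun _ _ => by simp) ?_ fun _ _ => rfl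
    · rintro ⟨s, a⟩ _ ⟨s', a'⟩ _ h
      exact Prod.ext (S.glue_inj h).1 (S.glue_inj h).2
    · intro v _ hv
      rw [hflow.divergence_eq_zero v, zero_mul]
      rintro (⟨a, rfl⟩ | ⟨a, rfl⟩)
      · exact hv ⟨(true, a), by simp, rfl⟩
      · exact hv ⟨(false, a), by simp, rfl⟩
  rw [← h, Fintype.sum_prod_type, Fintype.sum_bool, ← Finset.sum_add_distrib]
  refine Finset.sum_congr rfl fun a _ => ?_
  -- Conductive uniformity enters here: the divergence at `φ_-(a)` is `-J_p(a)`, so one density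
  -- serves both sides.
  have hu := hS p hp a
  simp only [divergence_glue]
  unfold fluxDensity
  rw [← neg_eq_iff_eq_neg.2 hu]
  ring

/-! ### Averaging over one level -/

theorem exists_lab_eq_glue (n : ℕ) (e : (S.G n).E) :
    ∃ s, ∀ b, (S.G n).lab e b = S.glue (xor b s) := by
  cases n with
  | zero => exact ⟨false, fun b => by simp [G, levelZero]⟩
  | succ n => exact S.exists_φ_eq_glue e.2

/-- The averaging operator from `V_{n+1}` to `V_n`. -/
noncomputable def averageStep (ν : S.I → ℝ) {n : ℕ} (f : (S.G (n + 1)).V → ℝ) (v : (S.G n).V) :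
    ℝ :=
  ∑ a, ν a * f (S.extend v a)

/-- The restriction of a function on `V_{n+1}` to the copy of the generator that replaces `e`. -/
def onCopy {n : ℕ} (f : (S.G (n + 1)).V → ℝ) (e : (S.G n).E) (x : S.V) : ℝ :=
  f (Quot.mk (S.glueRel (S.G n)) (x, e))

theorem energy_succ (p : ℝ) {n : ℕ} (f : (S.G (n + 1)).V → ℝ) :
    (S.G (n + 1)).energy p f = ∑ e, S.toMultiGraph.energy p (S.onCopy f e) :=
  Fintype.sum_prod_type (γ := ℝ) (α₁ := (S.G n).E) (α₂ := S.E) fun d =>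
    |f ((S.G (n + 1)).ends d true) - f ((S.G (n + 1)).ends d false)| ^ p

theorem averageStep_ends (ν : S.I → ℝ) {n : ℕ} (f : (S.G (n + 1)).V → ℝ) (e : (S.G n).E)
    (b : Bool) : S.averageStep ν f ((S.G n).ends e b) =
      ∑ a, ν a * S.onCopy f e ((S.G n).lab e b a) := by
  unfold averageStep onCopy
  simp only [S.extend_eq _ _ e b rfl]

/-- The energy at level `n + 1` splits over the copies of the generator, so the estimate holds edge
by edge. -/
theorem energy_averageStep_le (hS : S.ConductivelyUniform) {p : ℝ} (hp : 1 < p) {n : ℕ}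
    (f : (S.G (n + 1)).V → ℝ) :
    (S.G n).energy p (S.averageStep (S.fluxDensity p) f) ≤
      (S.capConst p)⁻¹ * (S.G (n + 1)).energy p f := by
  rw [energy_succ, Finset.mul_sum]
  refine Finset.sum_le_sum fun e _ => ?_
  rw [← S.flowEnergy_flow hp]
  refine Eq.trans_le ?_ (S.toMultiGraph.abs_pairing_rpow_le hp (S.flow p) (S.onCopy f e))
  rw [← S.sum_fluxDensity_mul_sub hS hp, averageStep_ends, averageStep_ends,
    ← Finset.sum_sub_distrib]
  obtain ⟨s, hs⟩ := S.exists_lab_eq_glue n e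
  simp only [hs, ← mul_sub]
  -- A swapped labelling only changes the sign of the difference.
  cases s
  · rfl
  · rw [← abs_neg, ← Finset.sum_neg_distrib]
    simp only [← mul_neg, neg_sub]
    rfl

theorem average_succ (ν : S.I → ℝ) (m k : ℕ) (f : (S.G (m + (k + 1))).V → ℝ) :
    S.average ν m (k + 1) f = S.average ν m k (S.averageStep ν (n := m + k) f) := by
  ext v
  unfold average averageStep
  rw [← (Fin.snocEquiv fun _ : Fin (k + 1) => S.I).sum_comp, Fintype.sum_prod_type,
    Finset.sum_comm]
  refine Finset.sum_congr rfl fun a _ => ?_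
  rw [Finset.mul_sum]
  refine Finset.sum_congr rfl fun c _ => ?_
  simp only [Fin.snocEquiv, Equiv.coe_fn_mk, Fin.prod_univ_castSucc, Fin.snoc_castSucc,
    Fin.snoc_last, extendWord, Fin.init_snoc, mul_assoc]

theorem average_zero (ν : S.I → ℝ) (m : ℕ) (f : (S.G m).V → ℝ) : S.average ν m 0 f = f := by
  ext v
  simp [average, extendWord]

theorem energy_average_le (hS : S.ConductivelyUniform) {p : ℝ} (hp : 1 < p) (m k : ℕ)
    (f : (S.G (m + k)).V → ℝ) :
    (S.G m).energy p (S.average (S.fluxDensity p) m k f) ≤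
      S.capConst p ^ (-(k : ℤ)) * (S.G (m + k)).energy p f := by
  induction k with
  | zero =>
    rw [average_zero]
    simp
  | succ k ih =>
    rw [average_succ]
    refine (ih _).trans ?_
    have hc := S.capConst_pos hp
    have h : S.capConst p ^ (-((k + 1 : ℕ) : ℤ)) =
        S.capConst p ^ (-(k : ℤ)) * (S.capConst p)⁻¹ := by
      rw [Nat.cast_add, Nat.cast_one, neg_add, zpow_add₀ hc.ne', zpow_neg_one]
    rw [h, mul_assoc]
    exact mul_le_mul_of_nonneg_left (S.energy_averageStep_le hS hp (n := m + k) f)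
      (zpow_nonneg hc.le _)

/-! ### Common vertices of edges -/

theorem lab_inj {n : ℕ} (e : (S.G n).E) {b c : Bool} {a a' : S.I}
    (h : (S.G n).lab e b a = (S.G n).lab e c a') : b = c ∧ a = a' := by
  obtain ⟨s, hs⟩ := S.exists_lab_eq_glue n e
  rw [hs, hs] at h
  obtain ⟨h1, h2⟩ := S.glue_inj h
  exact ⟨by simpa using h1, h2⟩

theorem glueRel_symm (G : S.LabeledGraph) {x y : S.V × G.E} (h : S.glueRel G x y) :
    S.glueRel G y x := by
  obtain ⟨b, c, a, h1, h2, h3⟩ := h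
  exact ⟨c, b, a, h1.symm, h3, h2⟩

/-- By `lab_inj` the middle point determines the endpoint and the letter through which it is glued.
-/
theorem glueRel_trans (n : ℕ) {x y z : S.V × (S.G n).E} (h : S.glueRel (S.G n) x y)
    (h' : S.glueRel (S.G n) y z) : S.glueRel (S.G n) x z := by
  obtain ⟨b, c, a, h1, h2, h3⟩ := h
  obtain ⟨b', c', a', h1', h2', h3'⟩ := h'
  obtain ⟨rfl, rfl⟩ := S.lab_inj _ (h3.symm.trans h2')
  exact ⟨b, c', a, h1.trans h1', h2, h3'⟩

theorem eq_or_glueRel_of_mk_eq (n : ℕ) {x y : S.V × (S.G n).E}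
    (h : Quot.mk (S.glueRel (S.G n)) x = Quot.mk (S.glueRel (S.G n)) y) :
    x = y ∨ S.glueRel (S.G n) x y := by
  induction Quot.eqvGen_exact h with
  | rel _ _ hr => exact Or.inr hr
  | refl _ => exact Or.inl rfl
  | symm _ _ _ ih =>
    exact (ih (Quot.eqvGen_sound ‹_›)).imp Eq.symm (S.glueRel_symm _)
  | trans _ _ _ _ _ ih ih' =>
    rcases ih (Quot.eqvGen_sound ‹_›) with rfl | h1
    · exact ih' (Quot.eqvGen_sound ‹_›)
    · rcases ih' (Quot.eqvGen_sound ‹_›) with rfl | h2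
      · exact Or.inr h1
      · exact Or.inr (S.glueRel_trans n h1 h2)

/-- Two edges of `G_n` have a common vertex. -/
def Meets {n : ℕ} (e e' : (S.G n).E) : Prop :=
  ∃ b c, (S.G n).ends e b = (S.G n).ends e' c

/-- Equal vertices are either the same point of one copy, whence equal projections, or glued, whence
the projections share an endpoint. -/
theorem Meets.projection {S : GeometricIGS.{u}} {n : ℕ} {e e' : (S.G (n + 1)).E}
    (h : S.Meets e e') : S.Meets (n := n) e.1 e'.1 := by
  obtain ⟨b, c, h⟩ := h
  rcases S.eq_or_glueRel_of_mk_eq n h with h | ⟨b', c', _, h, _⟩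
  · exact ⟨true, true, congrArg (fun x => (S.G n).ends x true) (congrArg Prod.snd h)⟩
  · exact ⟨b', c', h⟩

theorem meets_word_of_le {ω η : ℕ → S.E} {N M : ℕ} (hNM : N ≤ M)
    (h : S.Meets (S.word ω M) (S.word η M)) : S.Meets (S.word ω N) (S.word η N) := by
  induction hNM with
  | refl => exact h
  | step _ ih => exact ih h.projection

/-! ### Coding sequences of points of a fiber -/

theorem prepend_add (n : ℕ) (e : (S.G n).E) (ω : ℕ → S.E) (k : ℕ) :
    S.prepend n e ω (n + k) = ω k := by
  induction n generalizing k ω with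
  | zero => simp [prepend]
  | succ n ih =>
    rw [Nat.add_right_comm]
    exact ih e.1 (fun k => Nat.casesOn k e.2 ω) (k + 1)

theorem word_prepend (n : ℕ) (e : (S.G n).E) (ω : ℕ → S.E) :
    S.word (S.prepend n e ω) n = e := by
  induction n generalizing ω with
  | zero => rfl
  | succ n ih =>
    exact Prod.ext (ih e.1 _)
      (S.prepend_add n e.1 (fun k => Nat.casesOn (motive := fun _ => S.E) k e.2 ω) 0)

/-- The sequence `T_{v,e}(a)` in coordinates. -/
noncomputable def fiberCode {n : ℕ} (d : (S.G n).E × Bool) (a : ℕ → S.I) : ℕ → S.E :=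
  S.prepend n d.1 fun k => (S.descend d a (k + 1)).1.2

theorem word_fiberCode {n : ℕ} (d : (S.G n).E × Bool) (a : ℕ → S.I) (k : ℕ) :
    S.word (S.fiberCode d a) (n + k) = (S.descend d a k).1 := by
  induction k with
  | zero => exact S.word_prepend n d.1 _
  | succ k ih =>
    exact Prod.ext ih (S.prepend_add n d.1 (fun k => (S.descend d a (k + 1)).1.2) k)

theorem childDart_ends {n : ℕ} (d : (S.G n).E × Bool) (a : S.I) :
    (S.G (n + 1)).ends (S.childDart d a).1 (S.childDart d a).2 =
      S.extend ((S.G n).ends d.1 d.2) a := by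
  rw [S.extend_eq _ a d.1 d.2 rfl]
  exact congrArg (fun x => Quot.mk (S.glueRel (S.G n)) (x, d.1))
    (S.dartAt_ends ((S.G n).lab d.1 d.2 a))

theorem descend_ends_congr {n : ℕ} {d d' : (S.G n).E × Bool}
    (h : (S.G n).ends d.1 d.2 = (S.G n).ends d'.1 d'.2) (a : ℕ → S.I) (k : ℕ) :
    (S.G (n + k)).ends (S.descend d a k).1 (S.descend d a k).2 =
      (S.G (n + k)).ends (S.descend d' a k).1 (S.descend d' a k).2 := by
  induction k with
  | zero => exact h
  | succ k ih =>
    refine (S.childDart_ends (n := n + k) _ _).trans (Eq.trans ?_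
      (S.childDart_ends (n := n + k) _ _).symm)
    rw [ih]

/-- The map onto the fiber of a vertex does not depend on the edge containing the vertex. -/
theorem fiberMap_congr {n : ℕ} {d d' : (S.G n).E × Bool}
    (h : (S.G n).ends d.1 d.2 = (S.G n).ends d'.1 d'.2) (a : ℕ → S.I) :
    S.fiberMap d a = S.fiberMap d' a := by
  -- The descents are compared at level `n + N`; meeting there implies meeting at level `N`.
  refine Quot.sound fun N => S.meets_word_of_le (Nat.le_add_left N n) ?_
  refine ⟨(S.descend d a N).2, (S.descend d' a N).2, ?_⟩
  have h1 := S.word_fiberCode d a N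
  have h2 := S.word_fiberCode d' a N
  unfold fiberCode at h1 h2
  rw [h1, h2]
  exact S.descend_ends_congr h a N

/-- The sequence with first term `x` and tail `a`. -/
def consSeq {α : Type*} (x : α) (a : ℕ → α) (k : ℕ) : α := Nat.casesOn k x a

/-- The two darts live over differently written levels. Only their last generator edge and endpoint
index are compared; these fix the label and so the next step. -/
theorem descend_consSeq {n : ℕ} (d : (S.G n).E × Bool) (x : S.I) (a : ℕ → S.I) (k : ℕ) :
    ((S.descend d (consSeq x a) (k + 2)).1.2, (S.descend d (consSeq x a) (k + 2)).2) =
      ((S.descend (S.childDart d x) a (k + 1)).1.2, (S.descend (S.childDart d x) a (k + 1)).2) := by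
  induction k with
  | zero => rfl
  | succ k ih =>
    exact congrArg (fun c : S.E × Bool => S.dartAt (S.φ c.1 c.2 (a (k + 1)))) ih

theorem fiberMap_consSeq {n : ℕ} (d : (S.G n).E × Bool) (x : S.I) (a : ℕ → S.I) :
    S.fiberMap d (consSeq x a) = S.fiberMap (S.childDart d x) a := by
  refine congrArg S.coding ?_
  change S.prepend n d.1 _ = S.prepend n d.1 _
  congr 1
  funext k
  cases k with
  | zero => rfl
  | succ k => exact congrArg Prod.fst (S.descend_consSeq d x a k)

/-! ### Continuity of the maps onto the fibers -/

/-- Distance 0 is excluded by disjointness of `I_±`, distance 1 by non-degeneracy. Hence `L_*^{-N}`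
tends to 0. -/
theorem two_le_scale : 2 ≤ S.scale := by
  obtain ⟨a, a', h⟩ : S.scale ∈ {l | ∃ a a',
      S.toMultiGraph.toSimple.dist (S.glue true a) (S.glue false a') = l} := by
    obtain ⟨a⟩ := S.nonemptyI
    exact Nat.sInf_mem ⟨_, a, a, rfl⟩
  by_contra! hlt
  have h01 : S.scale = 0 ∨ S.scale = 1 := by omega
  rcases h01 with h0 | h0 <;> rw [h0] at h
  · rw [S.connected.dist_eq_zero_iff] at h
    exact absurd (S.glue_inj h).1 (by decide)
  · exact S.nondegenerate a a' (SimpleGraph.dist_eq_one_iff_adj.1 h)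

theorem fst_le_of_mem_projections {n : ℕ} {e : (S.G n).E} {x : Σ j, (S.G j).E}
    (h : x ∈ S.projections n e) : x.1 ≤ n := by
  induction n with
  | zero => exact (congrArg Sigma.fst (mem_singleton_iff.1 h)).le
  | succ n ih =>
    rcases h with rfl | h
    · exact le_rfl
    · exact (ih h).trans n.le_succ

theorem mem_projections_self {n : ℕ} {e e' : (S.G n).E} :
    (⟨n, e'⟩ : Σ j, (S.G j).E) ∈ S.projections n e ↔ e' = e := by
  cases n with
  | zero => exact ⟨fun _ => rfl, fun _ => rfl⟩
  | succ n =>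
    constructor
    · rintro (h | h)
      · exact eq_of_heq (Sigma.mk.inj h).2
      · exact absurd (S.fst_le_of_mem_projections h) (Nat.not_succ_le_self n)
    · rintro rfl
      exact Or.inl rfl

theorem mem_projections_succ {n : ℕ} {e : (S.G (n + 1)).E} {x : Σ j, (S.G j).E} (hx : x.1 ≤ n) :
    x ∈ S.projections (n + 1) e ↔ x ∈ S.projections n e.1 := by
  refine ⟨fun h => h.resolve_left ?_, Or.inr⟩
  rintro rfl
  exact Nat.not_succ_le_self n hx

theorem word_mem_projections (ω : ℕ → S.E) {N n : ℕ} (h : N ≤ n) :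
    (⟨N, S.word ω N⟩ : Σ j, (S.G j).E) ∈ S.projections n (S.word ω n) := by
  induction h with
  | refl => exact S.mem_projections_self.2 rfl
  | step h ih => exact Or.inr ih

/-- Adjacency in `G_n` along an edge that projects to `x`. -/
def CellAdj (n : ℕ) (x : Σ j, (S.G j).E) (u w : (S.G n).V) : Prop :=
  ∃ e b, x ∈ S.projections n e ∧ (S.G n).ends e b = u ∧ (S.G n).ends e (!b) = w

theorem cellAdj_copy {n : ℕ} {x : Σ j, (S.G j).E} {e : (S.G n).E} (he : x ∈ S.projections n e)
    (v w : S.V) : Relation.ReflTransGen (S.CellAdj (n + 1) x)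
      (Quot.mk (S.glueRel (S.G n)) (v, e)) (Quot.mk (S.glueRel (S.G n)) (w, e)) := by
  obtain ⟨q⟩ := S.connected.preconnected v w
  induction q with
  | nil => exact .refl
  | cons h _ ih =>
    obtain ⟨_, f, b, rfl, rfl⟩ := h
    exact .head ⟨(e, f), b, Or.inr he, rfl, rfl⟩ ih

/-- A chain of edges at level `n` lifts to level `n + 1`: each copy of the generator is connected,
and copies over edges with a common vertex `v` share the point `v · a`. -/
theorem cellAdj_connected {j : ℕ} (e₀ : (S.G j).E) {n : ℕ} (hn : j ≤ n) :
    ∀ {e e' : (S.G n).E}, ⟨j, e₀⟩ ∈ S.projections n e → ⟨j, e₀⟩ ∈ S.projections n e' → ∀ b c,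
      Relation.ReflTransGen (S.CellAdj n ⟨j, e₀⟩) ((S.G n).ends e b) ((S.G n).ends e' c) := by
  induction hn with
  | refl =>
    intro e e' he he' b c
    obtain rfl := S.mem_projections_self.1 he
    obtain rfl := S.mem_projections_self.1 he'
    by_cases hbc : b = c
    · rw [hbc]
    · refine .single ⟨e₀, b, he, rfl, ?_⟩
      rw [Bool.eq_not.2 hbc, Bool.not_not]
  | @step n hn ih =>
    have key : ∀ {e : (S.G n).E}, ⟨j, e₀⟩ ∈ S.projections n e → ∀ b u,
        Relation.ReflTransGen (S.CellAdj n ⟨j, e₀⟩) ((S.G n).ends e b) u →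
        ∀ e' c, ⟨j, e₀⟩ ∈ S.projections n e' → (S.G n).ends e' c = u → ∀ v w,
        Relation.ReflTransGen (S.CellAdj (n + 1) ⟨j, e₀⟩)
          (Quot.mk (S.glueRel (S.G n)) (v, e)) (Quot.mk (S.glueRel (S.G n)) (w, e')) := by
      obtain ⟨a⟩ := S.nonemptyI
      have glue : ∀ {e e' : (S.G n).E} {b c}, (S.G n).ends e b = (S.G n).ends e' c →
          Quot.mk (S.glueRel (S.G n)) ((S.G n).lab e b a, e) =
            Quot.mk (S.glueRel (S.G n)) ((S.G n).lab e' c a, e') := fun h =>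
        Quot.sound ⟨_, _, a, h, rfl, rfl⟩
      intro e he b u hu
      induction hu with
      | refl =>
        intro e' c he' hc v w
        refine (S.cellAdj_copy he v ((S.G n).lab e b a)).trans ?_
        rw [glue hc.symm]
        exact S.cellAdj_copy he' _ _
      | tail _ hstep ih' =>
        intro e' c he' hc v w
        obtain ⟨g, b', hg, h1, h2⟩ := hstep
        refine (ih' g b' hg h1 v ((S.G n).lab g (!b') a)).trans ?_
        rw [glue (h2.trans hc.symm)]
        exact S.cellAdj_copy he' _ _
    intro e e' he he' b c
    rw [S.mem_projections_succ hn] at he he'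
    exact key he true _ (ih he he' true true) _ true he' rfl _ _

theorem preconnected_cells {j : ℕ} (e₀ : (S.G j).E) {n : ℕ} (hn : j ≤ n) :
    ((S.G n).toSimple.induce (S.cells n {⟨j, e₀⟩})).Preconnected := by
  rintro ⟨u, hu⟩ ⟨w, hw⟩
  have key : ∀ {w}, Relation.ReflTransGen (S.CellAdj n ⟨j, e₀⟩) u w →
      ∃ hw : w ∈ S.cells n {⟨j, e₀⟩},
      ((S.G n).toSimple.induce (S.cells n {⟨j, e₀⟩})).Reachable ⟨u, hu⟩ ⟨w, hw⟩ := by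
    intro w h
    induction h with
    | refl => exact ⟨hu, .refl _⟩
    | tail _ hstep ih =>
      obtain ⟨hv, ih⟩ := ih
      obtain ⟨e, b, he, rfl, rfl⟩ := hstep
      have hv' : (S.G n).ends e (!b) ∈ S.cells n {⟨j, e₀⟩} :=
        ⟨e, !b, rfl, _, Finset.mem_singleton_self _, he⟩
      refine ⟨hv', ih.trans ?_⟩
      by_cases hne : (S.G n).ends e b = (S.G n).ends e (!b)
      · simp only [← hne]
        exact .refl _
      · exact SimpleGraph.Adj.reachable (G := (S.G n).toSimple.induce (S.cells n {⟨j, e₀⟩}))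
          (u := ⟨_, hv⟩) (v := ⟨_, hv'⟩) ⟨hne, e, b, rfl, rfl⟩
  obtain ⟨e, b, rfl, x, hx, he⟩ := hu
  obtain ⟨e', c, rfl, x', hx', he'⟩ := id hw
  obtain rfl := Finset.mem_singleton.1 hx
  obtain rfl := Finset.mem_singleton.1 hx'
  exact (key (S.cellAdj_connected e₀ hn he he' b c)).2

theorem levelDist_nonneg (n : ℕ) (v w : (S.G n).V) : 0 ≤ S.levelDist n v w := by
  refine Real.sInf_nonneg ?_
  rintro _ ⟨Ω, _, _, _, _, rfl⟩
  exact Finset.sum_nonneg fun _ _ => by positivity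

/-- The common edge at level `N` is by itself an admissible `Ω`, of cost `L_*^{-N}`. -/
theorem levelDist_le {ω η : ℕ → S.E} {N n : ℕ} (hn : N ≤ n) (h : S.word ω N = S.word η N)
    (b c : Bool) : S.levelDist n ((S.G n).ends (S.word ω n) b) ((S.G n).ends (S.word η n) c) ≤
      (S.scale : ℝ)⁻¹ ^ N := by
  refine csInf_le ⟨0, ?_⟩ ⟨{⟨N, S.word ω N⟩}, ?_, S.preconnected_cells _ hn, ?_, ?_, ?_⟩
  · rintro _ ⟨Ω, _, _, _, _, rfl⟩
    exact Finset.sum_nonneg fun _ _ => by positivity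
  · simpa using hn
  · exact ⟨_, _, rfl, _, Finset.mem_singleton_self _, S.word_mem_projections ω hn⟩
  · exact ⟨_, _, rfl, _, Finset.mem_singleton_self _, h ▸ S.word_mem_projections η hn⟩
  · simp

theorem iInf_levelDist_nonneg (ω η : ℕ → S.E) (n : ℕ) :
    0 ≤ ⨅ bc : Bool × Bool, S.levelDist n ((S.G n).ends (S.word ω n) bc.1)
      ((S.G n).ends (S.word η n) bc.2) :=
  Real.iInf_nonneg fun _ => S.levelDist_nonneg _ _ _

theorem codeDist_le {ω η : ℕ → S.E} {N : ℕ} (h : S.word ω N = S.word η N) :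
    S.codeDist ω η ≤ (S.scale : ℝ)⁻¹ ^ N := by
  refine limsup_le_of_le ?_ ?_
  · exact isCoboundedUnder_le_of_le atTop fun n => S.iInf_levelDist_nonneg ω η n
  · filter_upwards [eventually_ge_atTop N] with n hn
    exact (ciInf_le (finite_range _).bddBelow (true, true)).trans (S.levelDist_le hn h _ _)

theorem codeDist_nonneg (ω η : ℕ → S.E) : 0 ≤ S.codeDist ω η := by
  refine le_limsup_of_frequently_le
    (Eventually.frequently (Eventually.of_forall fun n => S.iInf_levelDist_nonneg ω η n)) ?_
  -- All codes agree at level 0, which bounds the sequence and makes its real `limsup` meaningful.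
  refine isBoundedUnder_of_eventually_le (a := (S.scale : ℝ)⁻¹ ^ 0) ?_
  exact Eventually.of_forall fun n =>
    (ciInf_le (finite_range _).bddBelow (true, true)).trans
      (S.levelDist_le (ω := ω) (η := η) (Nat.zero_le n) rfl _ _)

/-- This upper bound is all that continuity needs; no metric axiom is used. -/
theorem limitDist_coding_le {ω η : ℕ → S.E} {N : ℕ} (h : S.word ω N = S.word η N) :
    S.limitDist (S.coding ω) (S.coding η) ≤ (S.scale : ℝ)⁻¹ ^ N := by
  have hbdd : BddBelow {r | ∃ ω' η', S.coding ω' = S.coding ω ∧ S.coding η' = S.coding η ∧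
      S.codeDist ω' η' = r} := by
    refine ⟨0, ?_⟩
    rintro _ ⟨ω', η', _, _, rfl⟩
    exact S.codeDist_nonneg ω' η'
  exact (csInf_le hbdd ⟨ω, η, rfl, rfl, rfl⟩).trans (S.codeDist_le h)

instance : TopologicalSpace S.I := ⊥

instance : DiscreteTopology S.I := ⟨rfl⟩

instance : BorelSpace S.I := ⟨borel_eq_top_of_discrete.symm⟩

theorem descend_congr {n : ℕ} (d : (S.G n).E × Bool) {a a' : ℕ → S.I} {N : ℕ}
    (h : ∀ k < N, a k = a' k) : S.descend d a N = S.descend d a' N := by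
  induction N with
  | zero => rfl
  | succ N ih =>
    have h1 := ih fun k hk => h k (hk.trans N.lt_succ_self)
    change S.childDart (n := n + N) _ _ = S.childDart (n := n + N) _ _
    rw [h1, h N N.lt_succ_self]

/-- Sequences agreeing in their first `N` letters have codes through the same edge of level `n + N`.
-/
theorem continuous_fiberMap {n : ℕ} (d : (S.G n).E × Bool) : Continuous (S.fiberMap d) := by
  refine continuous_def.2 fun U hU => isOpen_iff_mem_nhds.2 fun a ha => ?_
  obtain ⟨ε, hε, hU⟩ := hU _ ha
  have h2 : (2 : ℝ) ≤ S.scale := by exact_mod_cast S.two_le_scale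
  have h0 : (0 : ℝ) ≤ (S.scale : ℝ)⁻¹ := by positivity
  have h1 : (S.scale : ℝ)⁻¹ < 1 := inv_lt_one_of_one_lt₀ (by linarith)
  obtain ⟨N, hN⟩ := exists_pow_lt_of_lt_one hε h1
  have hmem : (Iio N).pi (fun k => {a k}) ∈ 𝓝 a :=
    set_pi_mem_nhds (finite_Iio N) fun k _ => (isOpen_discrete _).mem_nhds rfl
  filter_upwards [hmem] with a' ha'
  refine hU _ (lt_of_le_of_lt (S.limitDist_coding_le (N := n + N) ?_)
    ((pow_le_pow_of_le_one h0 h1.le (Nat.le_add_left N n)).trans_lt hN))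
  refine (S.word_fiberCode d a N).trans (Eq.trans ?_ (S.word_fiberCode d a' N).symm)
  rw [S.descend_congr d fun k hk => (ha' k hk).symm]

/-! ### Discretization -/

theorem measurable_consSeq {α : Type*} [MeasurableSpace α] :
    Measurable fun x : α × (ℕ → α) => consSeq x.1 x.2 := by
  refine measurable_pi_lambda _ fun k => ?_
  cases k with
  | zero => exact measurable_fst
  | succ k => exact (measurable_pi_apply k).comp measurable_snd

/-- Splitting off the first factor of an infinite power of a probability measure. -/
theorem map_consSeq_prod_infinitePi {α : Type*} [MeasurableSpace α] (μ : Measure α)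
    [IsProbabilityMeasure μ] :
    (μ.prod (Measure.infinitePi fun _ : ℕ => μ)).map (fun x => consSeq x.1 x.2) =
      Measure.infinitePi fun _ : ℕ => μ := by
  classical
  refine Measure.eq_infinitePi _ fun s t ht => ?_
  obtain ⟨N, hN⟩ := s.exists_nat_subset_range
  -- Padding with `univ` turns the cylinder into one over an initial segment, which splits into head
  -- and shifted tail.
  let t' : ℕ → Set α := fun i => if i ∈ s then t i else univ
  have ht' : ∀ i, MeasurableSet (t' i) := fun i => by
    by_cases hi : i ∈ s
    · simpa [t', hi] using ht i
    · simp [t', hi]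
  have hpre : (fun x : α × (ℕ → α) => consSeq x.1 x.2) ⁻¹' ((s : Set ℕ).pi t) =
      t' 0 ×ˢ ((Finset.range N : Set ℕ).pi fun i => t' (i + 1)) := by
    ext ⟨x, a⟩
    simp only [mem_preimage, mem_prod, Set.mem_pi, Finset.mem_coe, Finset.mem_range]
    constructor
    · intro h
      have h' : ∀ i, consSeq x a i ∈ t' i := fun i => by
        by_cases hi : i ∈ s
        · simpa [t', hi] using h i hi
        · simp [t', hi]
      exact ⟨h' 0, fun i _ => h' (i + 1)⟩
    · rintro ⟨h0, h1⟩ i hi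
      have : consSeq x a i ∈ t' i := by
        cases i with
        | zero => exact h0
        | succ i => exact h1 i ((Nat.lt_succ_self i).trans (Finset.mem_range.1 (hN hi)))
      simpa [t', hi] using this
  rw [Measure.map_apply measurable_consSeq (.pi s.countable_toSet fun i _ => ht i), hpre,
    Measure.prod_prod, Measure.infinitePi_pi _ fun i _ => ht' (i + 1), mul_comm,
    ← Finset.prod_range_succ' fun i => μ (t' i)]
  have hsub : s ⊆ Finset.range (N + 1) := hN.trans (Finset.range_mono N.le_succ)
  rw [← Finset.prod_subset hsub fun i _ hi => by simp [t', hi]]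
  exact Finset.prod_congr rfl fun i hi => by simp [t', hi]

theorem integral_gluingMeasure (ν : S.I → ℝ) (hν : S.IsDensity ν) (g : S.I → ℝ) :
    ∫ a, g a ∂S.gluingMeasure ν hν = ∑ a, ν a * g a := by
  unfold gluingMeasure
  rw [PMF.integral_eq_sum]
  refine Finset.sum_congr rfl fun a _ => ?_
  rw [PMF.ofFintype_apply, ENNReal.toReal_ofReal (hν.nonneg a), smul_eq_mul]

/-- Frees the fiber integral from the chosen dart, so that `childDart d x` can represent `v · x`. -/
theorem discretize_eq_integral (ν : S.I → ℝ) (hν : S.IsDensity ν) {n : ℕ}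
    (f : C(S.LimitSpace, ℝ)) (d : (S.G n).E × Bool) :
    S.discretize ν hν n f ((S.G n).ends d.1 d.2) =
      ∫ a, f (S.fiberMap d a) ∂Measure.infinitePi fun _ : ℕ => S.gluingMeasure ν hν := by
  unfold discretize fiberMeasure
  rw [integral_map (S.continuous_fiberMap _).measurable.aemeasurable
    f.continuous.aestronglyMeasurable]
  refine integral_congr_ae (Eventually.of_forall fun a => congrArg f ?_)
  exact S.fiberMap_congr ((S.G n).exists_dart ((S.G n).ends d.1 d.2)).choose_spec a

theorem discretize_eq_averageStep (ν : S.I → ℝ) (hν : S.IsDensity ν) (n : ℕ)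
    (f : C(S.LimitSpace, ℝ)) :
    S.discretize ν hν n f = S.averageStep ν (S.discretize ν hν (n + 1) f) := by
  ext v
  obtain ⟨d, rfl⟩ := (S.G n).exists_dart v
  have hcont : Continuous fun a => f (S.fiberMap d a) :=
    f.continuous.comp (S.continuous_fiberMap d)
  have hint : Integrable (fun a => f (S.fiberMap d a))
      (Measure.infinitePi fun _ : ℕ => S.gluingMeasure ν hν) :=
    hcont.integrable_of_hasCompactSupport (.of_compactSpace _)
  rw [discretize_eq_integral]
  rw [← map_consSeq_prod_infinitePi (S.gluingMeasure ν hν)] at hint ⊢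
  have hint' : Integrable (fun x : S.I × (ℕ → S.I) => f (S.fiberMap d (consSeq x.1 x.2)))
      ((S.gluingMeasure ν hν).prod (Measure.infinitePi fun _ : ℕ => S.gluingMeasure ν hν)) :=
    (integrable_map_measure hint.aestronglyMeasurable measurable_consSeq.aemeasurable).1 hint
  rw [integral_map measurable_consSeq.aemeasurable hint.aestronglyMeasurable,
    integral_prod _ hint', integral_gluingMeasure]
  unfold averageStep
  refine Finset.sum_congr rfl fun x _ => ?_
  rw [← childDart_ends, discretize_eq_integral]
  simp only [fiberMap_consSeq]

theorem monotone_energy_discretize (hS : S.ConductivelyUniform) {p : ℝ} (hp : 1 < p)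
    (hJ : S.IsDensity (S.fluxDensity p)) (f : C(S.LimitSpace, ℝ)) :
    Monotone fun n : ℕ => S.capConst p ^ (-(n : ℤ)) *
      (S.G n).energy p (S.discretize (S.fluxDensity p) hJ n f) := by
  refine monotone_nat_of_le_succ fun n => ?_
  have hc := S.capConst_pos hp
  have h : S.capConst p ^ (-((n + 1 : ℕ) : ℤ)) =
      S.capConst p ^ (-(n : ℤ)) * (S.capConst p)⁻¹ := by
    rw [Nat.cast_add, Nat.cast_one, neg_add, zpow_add₀ hc.ne', zpow_neg_one]
  rw [h, mul_assoc, S.discretize_eq_averageStep _ hJ n f]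
  exact mul_le_mul_of_nonneg_left (S.energy_averageStep_le hS hp _) (zpow_nonneg hc.le _)

end GeometricIGS

theorem mainTheorem4 (S : GeometricIGS.{u}) (hS : S.ConductivelyUniform) (p : ℝ) (hp : 1 < p) :
    ∃ hJ : S.IsDensity (S.fluxDensity p),
      (∀ (m k : ℕ) (f : (S.G (m + k)).V → ℝ),
        (S.G m).energy p (S.average (S.fluxDensity p) m k f) ≤
          (S.capConst p) ^ (-(k : ℤ)) * (S.G (m + k)).energy p f) ∧
      ∀ f : C(S.LimitSpace, ℝ),
        Monotone (fun n : ℕ => (S.capConst p) ^ (-(n : ℤ)) *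
          (S.G n).energy p (S.discretize (S.fluxDensity p) hJ n f)) ∧
        ∃ L : ℝ≥0∞, Tendsto (fun n : ℕ => ENNReal.ofReal ((S.capConst p) ^ (-(n : ℤ)) *
          (S.G n).energy p (S.discretize (S.fluxDensity p) hJ n f))) atTop (𝓝 L) := by
  refine ⟨S.isDensity_fluxDensity hp, S.energy_average_le hS hp, fun f => ?_⟩
  have hmono := S.monotone_energy_discretize hS hp (S.isDensity_fluxDensity hp) f
  exact ⟨hmono, _, tendsto_atTop_iSup (ENNReal.ofReal_mono.comp hmono)⟩
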